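/- **Setting.** Let $G$ be a second countable, locally compact Hausdorff group with right Haar measure $\lambda$, and let $a\in G$ be aperiodic, i.e. the closed subgroup of $G$ generated by $a$ is not compact. Let $\Phi:\mathbb R\to\mathbb R$ be a Young function (continuous, even, convex, $\Phi(0)=0$, $\Phi(t)>0$ for $t>0$, $\lim_{t\to\infty}\Phi(t)=\infty$) which is $\Delta_2$-regular: there are $M>0$ and $t_0>0$ with $\Phi(2t)\le M\Phi(t)$ for all $t\ge t_0$ if $G$ is compact, and there is $M>0$ with $\Phi(2t)\le M\Phi(t)$ for all $t>0$ if $G$ is noncompact. Let $L^\Phi(G)$ be the Orlicz space of (classes modulo equality $\lambda$-a.e. of) Borel functions $f:G\to\mathbb C$ such that $\int_G\Phi(\alpha|f|)\,d\lambda<\infty$ for some $\alpha>0$, with the Luxemburg norm $N_\Phi(f)=\inf\{k>0:\int_G\Phi(|f|/k)\,d\lambda\le1\}$. Let $w:G\to(0,\infty)$ be a weight, i.e. bounded and continuous, with $w^{-1}\in L^\infty(G)$, and let $T=T_{a,w}$ be the weighted translation on $L^\Phi(G)$, $(Tf)(x)=w(x)f(xa^{-1})$. For $n\ge 0$ and $x\in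 G$ put $$\varphi_n(x)=\prod_{j=1}^{n}w(xa^{j}),\qquad \widetilde\varphi_n(x)=\Big(\prod_{j=0}^{n-1}w(xa^{-j})\Big)^{-1}.$$ Operators $T_1,\dots,T_L$ on a Banach space $X$ are *disjoint topologically transitive* if for all nonempty open sets $U,V_1,\dots,V_L\subset X$ there is an integer $n\ge1$ with $U\cap T_1^{-n}(V_1)\cap\dots\cap T_L^{-n}(V_L)\ne\emptyset$. **Corollary.** Let $L\ge2$ and let $1\le r_1<r_2<\dots<r_L$ be integers. The following are equivalent. 1. $T^{r_1},T^{r_2},\dots,T^{r_L}$ are disjoint topologically transitive on $L^\Phi(G)$. 2. For each compact set $K\subset G$ with $\lambda(K)>0$ there are a sequence of Borel sets $E_k\subset K$ with $\lim_{k\to\infty}\lambda(E_k)=\lambda(K)$ and a strictly increasing sequence of nonnegative integers $(n_k)$ such that, for $1\le l\le L$, $$\lim_{k\to\infty}\big\|\varphi_{r_ln_k}|_{E_k}\big\|_\infty=\lim_{k\to\infty}\big\|\widetilde\varphi_{r_ln_k}|_{E_k}\big\|_\infty=0,$$ and, for $1\le s<l\le L$, $$\lim_{k\to\infty}\big\|\widetilde\varphi_{(r_l-r_s)n_k}|_{E_k}\big\|_\infty=\lim_{k\to\infty}\big\|\varphi_{(r_l-r_s)n_k}|_{E_k}\big\|_\infty=0,$$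 where $\|\cdot\|_\infty$ is the $\lambda$-essential supremum norm on $E_k$. -/

import Mathlib

open MeasureTheory Filter Topology
open scoped ENNReal

/-! ### Disjoint transitivity -/

/-- Operators `T 1, …, T L` on a normed space are disjoint topologically transitive if for all
nonempty open sets `U, V 1, …, V L` there is a positive integer `n` such that
`U ∩ (T 1)⁻ⁿ(V 1) ∩ ⋯ ∩ (T L)⁻ⁿ(V L)` is nonempty. -/
def DisjointTransitive {X : Type*} [NormedAddCommGroup X] [NormedSpace ℂ X] {L : ℕ}
    (T : Fin L → X →L[ℂ] X) : Prop :=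
  ∀ (U : Set X) (V : Fin L → Set X), IsOpen U → U.Nonempty →
    (∀ l, IsOpen (V l)) → (∀ l, (V l).Nonempty) →
    ∃ n : ℕ, 0 < n ∧ (U ∩ ⋂ l, (fun x => (T l ^ n) x) ⁻¹' V l).Nonempty

/-! ### Young functions -/

/-- A Young function: continuous, even, convex `Φ : ℝ → ℝ` with `Φ 0 = 0`, `Φ t > 0` for `t > 0`
and `Φ t → ∞` as `t → ∞`. -/
structure YoungFunction where
  toFun : ℝ → ℝ
  continuous' : Continuous toFun
  even' : ∀ t, toFun (-t) = toFun t
  convex' : ConvexOn ℝ Set.univ toFun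
  zero' : toFun 0 = 0
  pos' : ∀ t, 0 < t → 0 < toFun t
  tendsto' : Tendsto toFun atTop atTop

namespace YoungFunction

instance : CoeFun YoungFunction (fun _ => ℝ → ℝ) := ⟨YoungFunction.toFun⟩

/-- `Δ₂`-regularity of `Φ` relative to the group (space) `G`: the doubling inequality is required
for large `t` only if `G` is compact and for all `t > 0` otherwise. -/
def IsDelta2Regular (Φ : YoungFunction) (G : Type*) [TopologicalSpace G] : Prop :=
  (CompactSpace G → ∃ M > 0, ∃ t₀ > 0, ∀ t ≥ t₀, Φ (2 * t) ≤ M * Φ t) ∧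
  (¬ CompactSpace G → ∃ M > 0, ∀ t > 0, Φ (2 * t) ≤ M * Φ t)

variable (Φ : YoungFunction)

lemma nonneg (t : ℝ) : 0 ≤ Φ t := by
  rcases lt_trichotomy t 0 with h | h | h
  · rw [← Φ.even' t]; exact (Φ.pos' _ (by linarith)).le
  · rw [h, Φ.zero']
  · exact (Φ.pos' _ h).le

lemma map_mul_le {c : ℝ} (h0 : 0 ≤ c) (h1 : c ≤ 1) (t : ℝ) : Φ (c * t) ≤ c * Φ t := by
  have := Φ.convex'.2 (Set.mem_univ t) (Set.mem_univ 0) h0 (sub_nonneg.2 h1) (by ring)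
  simpa [Φ.zero'] using this

lemma mono {s t : ℝ} (hs : 0 ≤ s) (hst : s ≤ t) : Φ s ≤ Φ t := by
  rcases (hs.trans hst).eq_or_lt with h | h
  · rw [show s = t by linarith]
  · have h1 : s / t ≤ 1 := (div_le_one h).2 hst
    have h2 := Φ.map_mul_le (div_nonneg hs h.le) h1 t
    rw [div_mul_cancel₀ _ h.ne'] at h2
    nlinarith [Φ.nonneg t]

lemma continuous : Continuous (fun t => Φ t) := Φ.continuous'

end YoungFunction

/-! ### Orlicz spaces -/

section Orlicz

variable {α : Type*} [MeasurableSpace α]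

/-- `∫ Φ(|f|) dμ`, as an extended nonnegative number. -/
noncomputable def orliczModular (Φ : YoungFunction) (μ : Measure α) (f : α → ℝ) : ℝ≥0∞ :=
  ∫⁻ x, ENNReal.ofReal (Φ |f x|) ∂μ

lemma orliczModular_mono (Φ : YoungFunction) {μ : Measure α} {f g : α → ℝ}
    (h : ∀ᵐ x ∂μ, |f x| ≤ |g x|) : orliczModular Φ μ f ≤ orliczModular Φ μ g :=
  lintegral_mono_ae (h.mono fun _ hx => ENNReal.ofReal_le_ofReal (Φ.mono (abs_nonneg _) hx))

lemma orliczModular_mul_le (Φ : YoungFunction) {μ : Measure α} (f : α → ℝ) {c : ℝ}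
    (h0 : 0 ≤ c) (h1 : c ≤ 1) :
    orliczModular Φ μ (fun x => c * f x) ≤ ENNReal.ofReal c * orliczModular Φ μ f := by
  unfold orliczModular
  rw [← lintegral_const_mul' _ _ ENNReal.ofReal_ne_top]
  refine lintegral_mono fun x => ?_
  rw [← ENNReal.ofReal_mul h0, abs_mul, abs_of_nonneg h0]
  exact ENNReal.ofReal_le_ofReal (Φ.map_mul_le h0 h1 _)

lemma orliczModular_convex (Φ : YoungFunction) {μ : Measure α} {f g : α → ℝ}
    (hf : AEMeasurable f μ) {s t : ℝ} (hs : 0 ≤ s) (ht : 0 ≤ t) (hst : s + t = 1) :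
    orliczModular Φ μ (fun x => s * |f x| + t * |g x|) ≤
      ENNReal.ofReal s * orliczModular Φ μ f + ENNReal.ofReal t * orliczModular Φ μ g := by
  unfold orliczModular
  have hm : AEMeasurable (fun x => ENNReal.ofReal s * ENNReal.ofReal (Φ |f x|)) μ :=
    ((Φ.continuous.measurable.comp_aemeasurable hf.abs).ennreal_ofReal).const_mul _
  rw [← lintegral_const_mul' _ _ ENNReal.ofReal_ne_top,
    ← lintegral_const_mul' _ _ ENNReal.ofReal_ne_top, ← lintegral_add_left' hm]
  refine lintegral_mono fun x => ?_
  rw [← ENNReal.ofReal_mul hs, ← ENNReal.ofReal_mul ht,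
    ← ENNReal.ofReal_add (mul_nonneg hs (Φ.nonneg _)) (mul_nonneg ht (Φ.nonneg _)),
    abs_of_nonneg (by positivity)]
  exact ENNReal.ofReal_le_ofReal (Φ.convex'.2 (Set.mem_univ _) (Set.mem_univ _) hs ht hst)

/-- The set of `f` (up to a.e. equality) with `∫ Φ(c|f|) dμ < ∞` for some `c > 0`. -/
def orliczSubmodule (Φ : YoungFunction) (μ : Measure α) : Submodule ℂ (α →ₘ[μ] ℂ) where
  carrier := {f | ∃ c > 0, orliczModular Φ μ (fun x => c * ‖f x‖) < ∞}
  zero_mem' := by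
    refine ⟨1, one_pos, ?_⟩
    have : orliczModular Φ μ (fun x => 1 * ‖(0 : α →ₘ[μ] ℂ) x‖) = 0 := by
      unfold orliczModular
      rw [lintegral_congr_ae (g := fun _ => 0)]
      · simp
      · filter_upwards [AEEqFun.coeFn_zero (μ := μ) (β := ℂ) (α := α)] with x hx
        simp [hx, Φ.zero']
    rw [this]; exact ENNReal.zero_lt_top
  add_mem' := by
    rintro f g ⟨c, hc, hf⟩ ⟨d, hd, hg⟩
    refine ⟨min c d / 2, by positivity, ?_⟩
    have hm : AEMeasurable (fun x => c * ‖f x‖) μ := f.aemeasurable.norm.const_mul c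
    refine lt_of_le_of_lt (orliczModular_mono Φ (g := fun x => 1 / 2 * |c * ‖f x‖| +
      1 / 2 * |d * ‖g x‖|) ?_) (lt_of_le_of_lt (orliczModular_convex Φ hm
        (by norm_num) (by norm_num) (by norm_num)) ?_)
    · filter_upwards [AEEqFun.coeFn_add f g] with x hx
      rw [hx, Pi.add_apply, abs_of_nonneg (by positivity), abs_of_nonneg (by positivity),
        abs_of_nonneg (by positivity), abs_of_nonneg (by positivity)]
      have h1 := norm_add_le (f x) (g x)
      have h2 := mul_le_mul_of_nonneg_right (min_le_left c d) (norm_nonneg (f x))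
      have h3 := mul_le_mul_of_nonneg_right (min_le_right c d) (norm_nonneg (g x))
      have h4 := mul_le_mul_of_nonneg_left h1 (lt_min hc hd).le
      linarith
    · exact ENNReal.add_lt_top.2 ⟨ENNReal.mul_lt_top ENNReal.ofReal_lt_top hf,
        ENNReal.mul_lt_top ENNReal.ofReal_lt_top hg⟩
  smul_mem' := by
    rintro a f ⟨c, hc, hf⟩
    refine ⟨c / (‖a‖ + 1), by positivity, lt_of_le_of_lt (orliczModular_mono Φ ?_) hf⟩
    filter_upwards [AEEqFun.coeFn_smul a f] with x hx
    rw [hx, Pi.smul_apply, norm_smul, abs_of_nonneg (by positivity),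
      abs_of_nonneg (by positivity)]
    have : ‖a‖ / (‖a‖ + 1) ≤ 1 := (div_le_one (by positivity)).2 (by linarith)
    calc c / (‖a‖ + 1) * (‖a‖ * ‖f x‖) = ‖a‖ / (‖a‖ + 1) * (c * ‖f x‖) := by ring
      _ ≤ 1 * (c * ‖f x‖) := mul_le_mul_of_nonneg_right this (by positivity)
      _ = c * ‖f x‖ := one_mul _

/-- The Orlicz space `L^Φ(μ)` of complex-valued functions, up to a.e. equality. -/
def OrliczSpace (Φ : YoungFunction) (μ : Measure α) : Type _ := ↥(orliczSubmodule Φ μ)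

namespace OrliczSpace

variable {Φ : YoungFunction} {μ : Measure α}

noncomputable instance : AddCommGroup (OrliczSpace Φ μ) := inferInstanceAs (AddCommGroup (orliczSubmodule Φ μ))

noncomputable instance : Module ℂ (OrliczSpace Φ μ) := inferInstanceAs (Module ℂ (orliczSubmodule Φ μ))

/-- The numbers `k > 0` with `∫ Φ(|f|/k) dμ ≤ 1`. -/
def normSet (Φ : YoungFunction) (μ : Measure α) (f : α → ℂ) : Set ℝ :=
  {k | 0 < k ∧ orliczModular Φ μ (fun x => ‖f x‖ / k) ≤ 1}

/-- The Luxemburg norm `N_Φ(f) = inf {k > 0 : ∫ Φ(|f|/k) dμ ≤ 1}`. -/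
noncomputable instance : Norm (OrliczSpace Φ μ) := ⟨fun f => sInf (normSet Φ μ f.1)⟩

lemma norm_def (f : OrliczSpace Φ μ) : ‖f‖ = sInf (normSet Φ μ f.1) := rfl

lemma normSet_bddBelow (f : α → ℂ) : BddBelow (normSet Φ μ f) := ⟨0, fun _ hk => hk.1.le⟩

lemma normSet_nonempty (f : OrliczSpace Φ μ) : (normSet Φ μ f.1).Nonempty := by
  obtain ⟨f, c, hc, hf⟩ := f
  set A := (orliczModular Φ μ (fun x => c * ‖f x‖)).toReal with hA
  have hA0 : 0 ≤ A := ENNReal.toReal_nonneg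
  refine ⟨(A + 1) / c, by positivity, ?_⟩
  have h := orliczModular_mul_le Φ (μ := μ) (fun x => c * ‖f x‖) (c := 1 / (A + 1))
    (by positivity) ((div_le_one (by positivity)).2 (by linarith))
  refine le_trans (le_of_eq ?_) (h.trans ?_)
  · congr 1; ext x; field_simp
  · rw [← ENNReal.ofReal_toReal hf.ne, ← hA, ← ENNReal.ofReal_mul (by positivity)]
    rw [← ENNReal.ofReal_one]
    refine ENNReal.ofReal_le_ofReal ?_
    rw [div_mul_eq_mul_div, one_mul]
    exact (div_le_one (by positivity)).2 (by linarith)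

lemma norm_nonneg' (f : OrliczSpace Φ μ) : 0 ≤ ‖f‖ := Real.sInf_nonneg fun _ hk => hk.1.le

lemma mem_normSet_of_lt (f : OrliczSpace Φ μ) {k : ℝ} (hk : ‖f‖ < k) : k ∈ normSet Φ μ f.1 := by
  obtain ⟨j, ⟨hj, hj'⟩, hjk⟩ := exists_lt_of_csInf_lt (normSet_nonempty f) hk
  refine ⟨hj.trans hjk, (orliczModular_mono Φ (ae_of_all _ fun x => ?_)).trans hj'⟩
  have := hj.trans hjk
  rw [abs_of_nonneg (by positivity), abs_of_nonneg (by positivity)]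
  gcongr

lemma norm_le_of_mem (f : OrliczSpace Φ μ) {k : ℝ} (hk : k ∈ normSet Φ μ f.1) : ‖f‖ ≤ k :=
  csInf_le (normSet_bddBelow _) hk

/-- Comparison principle for the Luxemburg norm. -/
lemma norm_le_of_forall (f g : OrliczSpace Φ μ) {C : ℝ} (hC : 0 ≤ C)
    (h : ∀ k ∈ normSet Φ μ f.1, ∀ D > C, D * k ∈ normSet Φ μ g.1) : ‖g‖ ≤ C * ‖f‖ := by
  have key : ∀ D > C, ∀ k > ‖f‖, ‖g‖ ≤ D * k := fun D hD k hk =>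
    norm_le_of_mem g (h k (mem_normSet_of_lt f hk) D hD)
  have h1 : ∀ D > C, ‖g‖ ≤ D * ‖f‖ := fun D hD => by
    have hD0 : 0 < D := lt_of_le_of_lt hC hD
    have : ‖g‖ / D ≤ ‖f‖ := le_of_forall_gt_imp_ge_of_dense fun k hk =>
      (div_le_iff₀' hD0).2 (key D hD k hk)
    exact (div_le_iff₀' hD0).1 this
  refine ge_of_tendsto (x := 𝓝[>] C) (f := fun D => D * ‖f‖) ?_ ?_
  · exact ((continuous_id.mul continuous_const).tendsto C).mono_left nhdsWithin_le_nhds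
  · filter_upwards [self_mem_nhdsWithin] with D hD using h1 D hD

lemma norm_smul_le' (c : ℂ) (f : OrliczSpace Φ μ) : ‖c • f‖ ≤ ‖c‖ * ‖f‖ := by
  refine norm_le_of_forall _ _ (norm_nonneg c) fun k hk D hD => ?_
  have hD0 : 0 < D := lt_of_le_of_lt (norm_nonneg c) hD
  have hk0 := hk.1
  refine ⟨mul_pos hD0 hk0, (orliczModular_mono Φ ?_).trans hk.2⟩
  filter_upwards [AEEqFun.coeFn_smul c f.1] with x hx
  change |‖(c • f.1 : α →ₘ[μ] ℂ) x‖ / (D * k)| ≤ _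
  rw [hx, Pi.smul_apply, norm_smul, abs_of_nonneg (by positivity), abs_of_nonneg (by positivity),
    mul_div_mul_comm]
  exact mul_le_of_le_one_left (by positivity) ((div_le_one hD0).2 hD.le)

lemma norm_core : NormedSpace.Core ℂ (OrliczSpace Φ μ) where
  norm_nonneg := norm_nonneg'
  norm_smul c f := by
    refine le_antisymm (norm_smul_le' c f) ?_
    rcases eq_or_ne c 0 with rfl | hc
    · simpa using norm_nonneg' ((0 : ℂ) • f)
    · have h := norm_smul_le' c⁻¹ (c • f)
      rw [smul_smul, inv_mul_cancel₀ hc, one_smul, norm_inv] at h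
      have hc' : 0 < ‖c‖ := norm_pos_iff.2 hc
      calc ‖c‖ * ‖f‖ ≤ ‖c‖ * (‖c‖⁻¹ * ‖c • f‖) := mul_le_mul_of_nonneg_left h hc'.le
        _ = ‖c • f‖ := by field_simp
  norm_triangle f g := by
    have key : ∀ j > ‖f‖, ∀ k > ‖g‖, ‖f + g‖ ≤ j + k := fun j hj k hk => by
      obtain ⟨hj0, hj1⟩ := mem_normSet_of_lt f hj
      obtain ⟨hk0, hk1⟩ := mem_normSet_of_lt g hk
      refine norm_le_of_mem _ ⟨add_pos hj0 hk0, ?_⟩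
      have hm : AEMeasurable (fun x => ‖f.1 x‖ / j) μ := f.1.aemeasurable.norm.div_const j
      refine (orliczModular_mono Φ (g := fun x => j / (j + k) * |‖f.1 x‖ / j| +
        k / (j + k) * |‖g.1 x‖ / k|) ?_).trans ((orliczModular_convex Φ hm (by positivity)
          (by positivity) (by field_simp)).trans ?_)
      · filter_upwards [AEEqFun.coeFn_add f.1 g.1] with x hx
        change |‖(f.1 + g.1 : α →ₘ[μ] ℂ) x‖ / (j + k)| ≤ _
        rw [hx, Pi.add_apply, abs_of_nonneg (by positivity), abs_of_nonneg (by positivity),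
          abs_of_nonneg (by positivity), abs_of_nonneg (by positivity)]
        have h1 := norm_add_le (f.1 x) (g.1 x)
        calc ‖f.1 x + g.1 x‖ / (j + k) ≤ (‖f.1 x‖ + ‖g.1 x‖) / (j + k) := by gcongr
          _ = _ := by field_simp
      · calc _ ≤ ENNReal.ofReal (j / (j + k)) * 1 + ENNReal.ofReal (k / (j + k)) * 1 := by
              gcongr
          _ = 1 := by
              rw [mul_one, mul_one, ← ENNReal.ofReal_add (by positivity) (by positivity),
                ← ENNReal.ofReal_one]
              congr 1; field_simp
    have h2 : ∀ j > ‖f‖, ‖f + g‖ ≤ j + ‖g‖ := fun j hj => by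
      have : ‖f + g‖ - j ≤ ‖g‖ := le_of_forall_gt_imp_ge_of_dense fun k hk => by
        linarith [key j hj k hk]
      linarith
    have : ‖f + g‖ - ‖g‖ ≤ ‖f‖ := le_of_forall_gt_imp_ge_of_dense fun j hj => by
      linarith [h2 j hj]
    linarith
  norm_eq_zero_iff f := by
    constructor
    · intro h
      have hn : ∀ n : ℕ, orliczModular Φ μ (fun x => ‖f.1 x‖) ≤
          ENNReal.ofReal (1 / ((n : ℝ) + 1)) := fun n => by
        have hp : (0 : ℝ) < 1 / ((n : ℝ) + 1) := by positivity
        have h1 := (mem_normSet_of_lt f (k := 1 / ((n : ℝ) + 1)) (by rw [h]; exact hp)).2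
        have h2 := orliczModular_mul_le Φ (μ := μ) (fun x => ‖f.1 x‖ / (1 / ((n : ℝ) + 1)))
          hp.le ((div_le_one (by positivity)).2 (by linarith [Nat.cast_nonneg (α := ℝ) n]))
        calc orliczModular Φ μ (fun x => ‖f.1 x‖)
            = orliczModular Φ μ
                (fun x => 1 / ((n : ℝ) + 1) * (‖f.1 x‖ / (1 / ((n : ℝ) + 1)))) := by
              congr 1; ext x; field_simp
          _ ≤ ENNReal.ofReal (1 / ((n : ℝ) + 1)) * 1 := h2.trans (by gcongr)
          _ = _ := mul_one _
      have h0 : orliczModular Φ μ (fun x => ‖f.1 x‖) = 0 := by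
        refine le_antisymm (ge_of_tendsto' (x := atTop) ?_ hn) zero_le
        have := ENNReal.tendsto_ofReal tendsto_one_div_add_atTop_nhds_zero_nat
        simpa using this
      have hm : AEMeasurable (fun x => ENNReal.ofReal (Φ |‖f.1 x‖|)) μ :=
        (Φ.continuous.measurable.comp_aemeasurable f.1.aemeasurable.norm.abs).ennreal_ofReal
      rw [orliczModular, lintegral_eq_zero_iff' hm] at h0
      refine Subtype.ext (AEEqFun.ext ?_)
      filter_upwards [h0, AEEqFun.coeFn_zero (μ := μ) (β := ℂ) (α := α)] with x hx hx0
      change f.1 x = (0 : α →ₘ[μ] ℂ) x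
      rw [hx0]
      by_contra hne
      have := Φ.pos' _ (norm_pos_iff.2 hne)
      simp only [abs_norm, Pi.zero_apply, ENNReal.ofReal_eq_zero] at hx
      linarith
    · rintro rfl
      have := norm_smul_le' (0 : ℂ) (0 : OrliczSpace Φ μ)
      rw [smul_zero, norm_zero, zero_mul] at this
      exact le_antisymm this (norm_nonneg' _)

noncomputable instance : NormedAddCommGroup (OrliczSpace Φ μ) :=
  NormedAddCommGroup.ofCore norm_core

noncomputable instance : NormedSpace ℂ (OrliczSpace Φ μ) :=
  NormedSpace.ofCore norm_core

end OrliczSpace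

end Orlicz

/-! ### Weighted translations -/

/-- An element `a` of a topological group is aperiodic if the closed subgroup it generates is
not compact. -/
def IsAperiodic {G : Type*} [Group G] [TopologicalSpace G] [IsTopologicalGroup G] (a : G) : Prop :=
  ¬ IsCompact ((Subgroup.zpowers a).topologicalClosure : Set G)

/-- A weight on `G`: a bounded continuous function `w : G → (0, ∞)`. -/
structure Weight (G : Type*) [TopologicalSpace G] where
  toFun : G → ℝ
  continuous' : Continuous toFun
  pos' : ∀ x, 0 < toFun x
  bddAbove' : BddAbove (Set.range toFun)

instance {G : Type*} [TopologicalSpace G] : CoeFun (Weight G) (fun _ => G → ℝ) :=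
  ⟨Weight.toFun⟩

section Translation

variable {G : Type*} [Group G] [TopologicalSpace G] [IsTopologicalGroup G]
  [MeasurableSpace G] [BorelSpace G]

/-- The class of `x ↦ w x * f (x * a⁻¹)`. -/
noncomputable def weightedTranslationAux (μ : Measure G) [μ.IsMulRightInvariant] (a : G)
    (w : Weight G) (f : G →ₘ[μ] ℂ) : G →ₘ[μ] ℂ :=
  AEEqFun.mk (fun x => (w x : ℂ))
      (Complex.continuous_ofReal.comp w.continuous').aestronglyMeasurable *
    f.compMeasurePreserving (fun x => x * a⁻¹) (measurePreserving_mul_right μ a⁻¹)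

lemma coeFn_weightedTranslationAux (μ : Measure G) [μ.IsMulRightInvariant] (a : G)
    (w : Weight G) (f : G →ₘ[μ] ℂ) :
    weightedTranslationAux μ a w f =ᵐ[μ] fun x => (w x : ℂ) * f (x * a⁻¹) := by
  unfold weightedTranslationAux
  filter_upwards [AEEqFun.coeFn_mul (AEEqFun.mk (fun x => (w x : ℂ))
      (Complex.continuous_ofReal.comp w.continuous').aestronglyMeasurable (μ := μ))
    (f.compMeasurePreserving (fun x => x * a⁻¹) (measurePreserving_mul_right μ a⁻¹)),
    AEEqFun.coeFn_mk (fun x => (w x : ℂ))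
      (Complex.continuous_ofReal.comp w.continuous').aestronglyMeasurable (μ := μ),
    AEEqFun.coeFn_compMeasurePreserving f (measurePreserving_mul_right μ a⁻¹)] with x h1 h2 h3
  rw [h1, Pi.mul_apply, h2, h3, Function.comp]

/-- Right translation preserves the modular. -/
lemma orliczModular_translate (Φ : YoungFunction) (μ : Measure G) [μ.IsMulRightInvariant] (a : G)
    (f : G → ℝ) : orliczModular Φ μ (fun x => f (x * a⁻¹)) = orliczModular Φ μ f := by
  unfold orliczModular
  exact lintegral_mul_right_eq_self (fun x => ENNReal.ofReal (Φ |f x|)) a⁻¹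

/-- If `C ≥ 0` bounds `w`, then the modular of `w T_a f` is controlled by that of `C f`. -/
lemma orliczModular_weightedTranslationAux_le (Φ : YoungFunction) (μ : Measure G)
    [μ.IsMulRightInvariant] (a : G) (w : Weight G) (f : G →ₘ[μ] ℂ) {C : ℝ}
    (hC : ∀ x, w x ≤ C) {c : ℝ} (hc : 0 ≤ c) :
    orliczModular Φ μ (fun x => c * ‖weightedTranslationAux μ a w f x‖) ≤
      orliczModular Φ μ (fun x => c * C * ‖f x‖) := by
  rw [← orliczModular_translate Φ μ a (fun x => c * C * ‖f x‖)]
  refine orliczModular_mono Φ ?_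
  filter_upwards [coeFn_weightedTranslationAux μ a w f] with x hx
  have hw := w.pos' x
  have hC0 : 0 ≤ C := hw.le.trans (hC x)
  rw [hx, norm_mul, Complex.norm_real, Real.norm_of_nonneg hw.le, abs_of_nonneg (by positivity),
    abs_of_nonneg (by positivity), mul_assoc]
  gcongr
  exact hC x

/-- The weighted translation operator `T_{a,w} f = w · (f * δ_a)`, i.e.
`(T_{a,w} f)(x) = w(x) f(x a⁻¹)`, on `L^Φ(G)`. -/
noncomputable def weightedTranslation (Φ : YoungFunction) (μ : Measure G) [μ.IsMulRightInvariant]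
    (a : G) (w : Weight G) : OrliczSpace Φ μ →L[ℂ] OrliczSpace Φ μ :=
  LinearMap.mkContinuousOfExistsBound
    { toFun := fun f => ⟨weightedTranslationAux μ a w f.1, by
        obtain ⟨f, c, hc, hf⟩ := f
        obtain ⟨C, hC⟩ := w.bddAbove'
        have hC' : ∀ x, w x ≤ C := fun x => hC ⟨x, rfl⟩
        have hC0 : 0 < C := (w.pos' 1).trans_le (hC' 1)
        refine ⟨c / C, by positivity, lt_of_le_of_lt
          (orliczModular_weightedTranslationAux_le Φ μ a w f hC' (by positivity)) ?_⟩
        rwa [div_mul_cancel₀ _ hC0.ne']⟩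
      map_add' := fun f g => by
        refine Subtype.ext (AEEqFun.ext ?_)
        change weightedTranslationAux μ a w (f.1 + g.1) =ᵐ[μ]
          (weightedTranslationAux μ a w f.1 + weightedTranslationAux μ a w g.1 : G →ₘ[μ] ℂ)
        have hq := (measurePreserving_mul_right μ a⁻¹).quasiMeasurePreserving.ae
          (AEEqFun.coeFn_add f.1 g.1)
        filter_upwards [coeFn_weightedTranslationAux μ a w (f.1 + g.1),
          coeFn_weightedTranslationAux μ a w f.1, coeFn_weightedTranslationAux μ a w g.1,
          AEEqFun.coeFn_add (weightedTranslationAux μ a w f.1) (weightedTranslationAux μ a w g.1),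
          hq] with x h1 h2 h3 h4 h5
        rw [h1, h4, Pi.add_apply, h2, h3, h5, Pi.add_apply, mul_add]
      map_smul' := fun c f => by
        refine Subtype.ext (AEEqFun.ext ?_)
        change weightedTranslationAux μ a w (c • f.1) =ᵐ[μ]
          (c • weightedTranslationAux μ a w f.1 : G →ₘ[μ] ℂ)
        have hq := (measurePreserving_mul_right μ a⁻¹).quasiMeasurePreserving.ae
          (AEEqFun.coeFn_smul c f.1)
        filter_upwards [coeFn_weightedTranslationAux μ a w (c • f.1),
          coeFn_weightedTranslationAux μ a w f.1,
          AEEqFun.coeFn_smul c (weightedTranslationAux μ a w f.1), hq] with x h1 h2 h3 h4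
        rw [h1, h3, Pi.smul_apply, h2, h4, Pi.smul_apply, smul_eq_mul, smul_eq_mul]
        ring }
    (by
      obtain ⟨C, hC⟩ := w.bddAbove'
      have hC' : ∀ x, w x ≤ C := fun x => hC ⟨x, rfl⟩
      have hC0 : 0 < C := (w.pos' 1).trans_le (hC' 1)
      refine ⟨C, fun f => OrliczSpace.norm_le_of_forall _ _ hC0.le fun k hk D hD => ?_⟩
      have hk0 := hk.1
      have hD0 : 0 < D := hC0.trans hD
      refine ⟨mul_pos hD0 hk0, le_trans ?_ hk.2⟩
      have h := orliczModular_weightedTranslationAux_le Φ μ a w f.1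
        (fun x => (hC' x).trans hD.le) (c := 1 / (D * k)) (by positivity)
      refine le_trans (le_of_eq ?_) (h.trans (le_of_eq ?_))
      · congr 1; ext x
        change ‖weightedTranslationAux μ a w f.1 x‖ / (D * k) = _
        ring
      · congr 1; ext x; field_simp)

end Translation

/-- `φ_n = ∏_{j=1}^n w * δ_{a⁻¹}^j`, i.e. `φ_n(x) = ∏_{j=1}^n w(x a^j)`. -/
noncomputable def weightProd {G : Type*} [Group G] [TopologicalSpace G] (w : Weight G) (a : G)
    (n : ℕ) (x : G) : ℝ :=
  ∏ j ∈ Finset.Icc 1 n, w (x * a ^ j)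

/-- `φ̃_n = (∏_{j=0}^{n-1} w * δ_a^j)⁻¹`, i.e. `φ̃_n(x) = (∏_{j=0}^{n-1} w(x a^{-j}))⁻¹`. -/
noncomputable def weightProdTilde {G : Type*} [Group G] [TopologicalSpace G] (w : Weight G) (a : G)
    (n : ℕ) (x : G) : ℝ :=
  (∏ j ∈ Finset.range n, w (x * (a ^ j)⁻¹))⁻¹

/-! Write `φ_n`, `φ̃_n` for the weight products. The identity `(T^n f)(x a^n) = φ_n(x) f(x)` and
right invariance show that `T^n f` has the norm of `φ_n f`. Since `w⁻¹` is bounded, `T` is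
invertible; its inverse `S` is again a weighted translation, by `a⁻¹`, and its products are the
`φ̃_n`. So smallness of `φ_n` or `φ̃_n` on `E` means smallness of `T^n` or `S^n` on functions living
on `E`.

Products to transitivity: a compact group has no aperiodic element, so the doubling condition is
global. It gives density of functions vanishing off a compact set, and convergence of `1_{E_k} f` to
`f`. For such `f` and `g_l`, the vectors `z_k = 1_{E_k} f + ∑ S^{r_l n_k}(1_{E_k} g_l)` tend to `f`,
while `T^{r_l n_k} z_k` tends to `g_l`: each cross term is a power of `T` or `S` with exponent `|r_l
- r_s| n_k`.

Transitivity to products: choose `f` near `1_K` whose iterates `T^{r_l n} f` are all near `C • 1_K`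
with `C ≥ 1`. Outside sets of small measure, `f` and these iterates are large on `K` and small off
`K`. Large powers of `a` move `K` off itself (`IsAperiodic.eventually_mul_pow_notMem`), so passing
between two of these functions carries large values to small ones, and the corresponding product is
small (`weightProd_le_of_translate_small`). Taking `C` large forces `n` to be large. -/

namespace YoungFunction

variable (Φ : YoungFunction)

lemma two_pow_mul_le {M : ℝ} (hM : 0 < M) (h : ∀ t > 0, Φ (2 * t) ≤ M * Φ t) (n : ℕ) {t : ℝ}
    (ht : 0 ≤ t) : Φ (2 ^ n * t) ≤ M ^ n * Φ t := by
  rcases ht.eq_or_lt with rfl | ht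
  · simp [Φ.zero']
  induction n with
  | zero => simp
  | succ n ih =>
    calc Φ (2 ^ (n + 1) * t) = Φ (2 * (2 ^ n * t)) := by ring_nf
      _ ≤ M * Φ (2 ^ n * t) := h _ (by positivity)
      _ ≤ M * (M ^ n * Φ t) := by gcongr
      _ = M ^ (n + 1) * Φ t := by ring

end YoungFunction

/-! ### Convergence, truncation and density in the Orlicz space -/

namespace OrliczSpace

variable {α : Type*} [MeasurableSpace α] {Φ : YoungFunction} {μ : Measure α}

lemma coeFn_sub (f g : OrliczSpace Φ μ) : ∀ᵐ x ∂μ, (f - g).1 x = f.1 x - g.1 x :=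
  AEEqFun.coeFn_sub f.1 g.1

lemma coeFn_smul (c : ℂ) (f : OrliczSpace Φ μ) : ∀ᵐ x ∂μ, (c • f).1 x = c * f.1 x :=
  AEEqFun.coeFn_smul c f.1

/-- Under a global doubling condition all the modulars of `f ∈ L^Φ` are finite. -/
lemma modular_mul_lt_top {M : ℝ} (hM : 0 < M) (h : ∀ t > 0, Φ (2 * t) ≤ M * Φ t)
    (f : OrliczSpace Φ μ) {c : ℝ} (hc : 0 ≤ c) : orliczModular Φ μ (fun x => c * ‖f.1 x‖) < ∞ := by
  obtain ⟨f, d, hd, hf⟩ := f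
  obtain ⟨n, hn⟩ := pow_unbounded_of_one_lt (c / d) (one_lt_two (α := ℝ))
  rw [div_lt_iff₀ hd] at hn
  calc orliczModular Φ μ (fun x => c * ‖f x‖)
      ≤ ENNReal.ofReal (M ^ n) * orliczModular Φ μ (fun x => d * ‖f x‖) := by
        unfold orliczModular
        rw [← lintegral_const_mul' _ _ ENNReal.ofReal_ne_top]
        refine lintegral_mono fun x => ?_
        rw [← ENNReal.ofReal_mul (by positivity)]
        refine ENNReal.ofReal_le_ofReal ((Φ.mono (abs_nonneg _) ?_).trans
          (Φ.two_pow_mul_le hM h n (abs_nonneg _)))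
        rw [abs_of_nonneg (by positivity), abs_of_nonneg (by positivity), ← mul_assoc]
        exact mul_le_mul_of_nonneg_right hn.le (norm_nonneg _)
    _ < ∞ := ENNReal.mul_lt_top ENNReal.ofReal_lt_top hf

/-- Norm convergence implies convergence in measure. -/
lemma exists_measure_le_of_norm_lt (Φ : YoungFunction) (μ : Measure α) {η : ℝ} (hη : 0 < η)
    {ε : ℝ≥0∞} (hε : ε ≠ 0) :
    ∃ δ > 0, ∀ f : OrliczSpace Φ μ, ‖f‖ < δ → μ {x | η ≤ ‖f.1 x‖} ≤ ε := by
  obtain ⟨k, hk⟩ : ∃ k : ℝ, 0 < k ∧ ε⁻¹ ≤ ENNReal.ofReal (Φ (η / k)) := by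
    obtain ⟨t, ht1, ht⟩ := ((eventually_ge_atTop 1).and
      (Φ.tendsto'.eventually_ge_atTop (ε⁻¹.toReal))).exists
    refine ⟨η / t, by positivity, ?_⟩
    rw [div_div_cancel₀ hη.ne', ← ENNReal.ofReal_toReal (ENNReal.inv_ne_top.2 hε)]
    exact ENNReal.ofReal_le_ofReal ht
  refine ⟨k, hk.1, fun f hf => ?_⟩
  obtain ⟨hk0, hmod⟩ := mem_normSet_of_lt f hf
  have hsub : {x | η ≤ ‖f.1 x‖} ⊆ {x | ε⁻¹ ≤ ENNReal.ofReal (Φ |‖f.1 x‖ / k|)} := fun x hx => by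
    refine hk.2.trans (ENNReal.ofReal_le_ofReal (Φ.mono (by positivity) ?_))
    rw [abs_of_nonneg (by positivity)]
    exact div_le_div_of_nonneg_right hx hk0.le
  have hm : AEMeasurable (fun x => ENNReal.ofReal (Φ |‖f.1 x‖ / k|)) μ :=
    (Φ.continuous.measurable.comp_aemeasurable
      (f.1.aemeasurable.norm.div_const k).abs).ennreal_ofReal
  have h1 := (mul_meas_ge_le_lintegral₀ hm ε⁻¹).trans hmod
  refine (measure_mono hsub).trans ?_
  rw [mul_comm, ← div_eq_mul_inv] at h1
  rcases eq_or_ne ε ∞ with rfl | hε'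
  · exact le_top
  · simpa using (ENNReal.div_le_iff hε hε').1 h1

/-- The product of `f ∈ L^Φ` with the indicator function of a measurable set. -/
noncomputable def restrict (E : Set α) (hE : MeasurableSet E) (f : OrliczSpace Φ μ) :
    OrliczSpace Φ μ :=
  ⟨AEEqFun.mk (E.indicator f.1) (f.1.aestronglyMeasurable.indicator hE), by
    obtain ⟨f, c, hc, hf⟩ := f
    refine ⟨c, hc, (orliczModular_mono Φ ?_).trans_lt hf⟩
    filter_upwards [AEEqFun.coeFn_mk _ (f.aestronglyMeasurable.indicator hE)] with x hx
    rw [hx, abs_mul, abs_mul, abs_norm, abs_norm]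
    gcongr
    exact norm_indicator_le_norm_self _ _⟩

lemma coeFn_restrict (E : Set α) (hE : MeasurableSet E) (f : OrliczSpace Φ μ) :
    ∀ᵐ x ∂μ, (restrict E hE f).1 x = E.indicator f.1 x :=
  AEEqFun.coeFn_mk _ (f.1.aestronglyMeasurable.indicator hE)

lemma norm_mono {f g : OrliczSpace Φ μ} {C : ℝ} (hC : 0 ≤ C)
    (h : ∀ᵐ x ∂μ, ‖g.1 x‖ ≤ C * ‖f.1 x‖) : ‖g‖ ≤ C * ‖f‖ := by
  refine norm_le_of_forall f g hC fun k hk D hD => ?_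
  have hk0 := hk.1
  have hD0 : 0 < D := hC.trans_lt hD
  refine ⟨by positivity, (orliczModular_mono Φ ?_).trans hk.2⟩
  filter_upwards [h] with x hx
  rw [abs_of_nonneg (by positivity), abs_of_nonneg (by positivity),
    div_le_div_iff₀ (by positivity) hk0]
  calc ‖g.1 x‖ * k ≤ (D * ‖f.1 x‖) * k := by gcongr; exact hx.trans (by gcongr)
    _ = _ := by ring

lemma norm_restrict_le (E : Set α) (hE : MeasurableSet E) (f : OrliczSpace Φ μ) :
    ‖restrict E hE f‖ ≤ ‖f‖ := by
  rw [← one_mul ‖f‖]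
  refine norm_mono zero_le_one ?_
  filter_upwards [coeFn_restrict E hE f] with x hx
  rw [hx, one_mul]
  exact norm_indicator_le_norm_self _ _

/-- The difference vanishes on `E` and has modulus `|f|` off `E`, so the integral is exactly the
modular of the difference divided by `ε`. -/
lemma norm_restrict_sub_le {E : Set α} (hE : MeasurableSet E) (f : OrliczSpace Φ μ) {ε : ℝ}
    (hε : 0 < ε) (h : ∫⁻ x in Eᶜ, ENNReal.ofReal (Φ |‖f.1 x‖ / ε|) ∂μ ≤ 1) :
    ‖restrict E hE f - f‖ ≤ ε := by
  refine norm_le_of_mem _ ⟨hε, le_trans (le_of_eq ?_) h⟩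
  rw [← lintegral_indicator hE.compl]
  refine lintegral_congr_ae ?_
  filter_upwards [coeFn_restrict E hE f, coeFn_sub (restrict E hE f) f] with x hx hx'
  by_cases hxE : x ∈ E <;> simp [hx', hx, hxE, Φ.zero']

variable {M : ℝ}

/-- Absolute continuity of the norm. -/
lemma tendsto_restrict (hM : 0 < M) (h : ∀ t > 0, Φ (2 * t) ≤ M * Φ t) (f : OrliczSpace Φ μ)
    {K : Set α} (hK : MeasurableSet K) (hμK : μ K ≠ ∞) (hf : ∀ᵐ x ∂μ, x ∉ K → f.1 x = 0)
    {E : ℕ → Set α} (hE : ∀ k, MeasurableSet (E k)) (hEK : ∀ k, E k ⊆ K)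
    (hlim : Tendsto (fun k => μ (E k)) atTop (𝓝 (μ K))) :
    Tendsto (fun k => restrict (E k) (hE k) f) atTop (𝓝 f) := by
  rw [tendsto_iff_norm_sub_tendsto_zero]
  have hdiff : Tendsto (fun k => μ (K \ E k)) atTop (𝓝 0) := by
    have h1 := ENNReal.Tendsto.sub (tendsto_const_nhds (x := μ K)) hlim (Or.inl hμK)
    rw [tsub_self] at h1
    refine h1.congr fun k => ?_
    rw [measure_sdiff (hEK k) (hE k).nullMeasurableSet (measure_ne_top_of_subset (hEK k) hμK)]
  rw [tendsto_order]
  refine ⟨fun b hb => Eventually.of_forall fun k => hb.trans_le (norm_nonneg _), fun b hb => ?_⟩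
  set ε := b / 2
  have hε : 0 < ε := by positivity
  -- Doubling makes `Φ(|f|/ε)` integrable for every `ε > 0`. As `f` vanishes off `K`, its integral
  -- over the complement of `E k` is that over `K \ E k`, which is small by absolute continuity of
  -- the integral.
  have hfin : ∫⁻ x, ENNReal.ofReal (Φ |‖f.1 x‖ / ε|) ∂μ ≠ ∞ := by
    have := modular_mul_lt_top hM h f (c := ε⁻¹) (by positivity)
    simpa only [orliczModular, div_eq_inv_mul] using this.ne
  obtain ⟨δ, hδ, hδ'⟩ := exists_pos_setLIntegral_lt_of_measure_lt hfin one_ne_zero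
  filter_upwards [hdiff.eventually_lt_const hδ] with k hk
  refine (norm_restrict_sub_le (hE k) f hε (le_trans ?_ (hδ' _ hk).le)).trans_lt (half_lt_self hb)
  rw [← lintegral_indicator (hE k).compl, ← lintegral_indicator (hK.diff (hE k))]
  refine lintegral_mono_ae ?_
  filter_upwards [hf] with x hx
  by_cases hxE : x ∈ E k <;> by_cases hxK : x ∈ K <;> simp [hxE, hxK, hx, Φ.zero']

/-- The measure with density `Φ(|f|/ε)` is finite by doubling, hence continuous from above along the
complements of the `E k`, which decrease to the empty set. -/
lemma tendsto_restrict_of_monotone (hM : 0 < M) (h : ∀ t > 0, Φ (2 * t) ≤ M * Φ t)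
    (f : OrliczSpace Φ μ) {E : ℕ → Set α} (hE : ∀ k, MeasurableSet (E k)) (hmono : Monotone E)
    (hun : ⋃ k, E k = Set.univ) :
    Tendsto (fun k => restrict (E k) (hE k) f) atTop (𝓝 f) := by
  rw [tendsto_iff_norm_sub_tendsto_zero, tendsto_order]
  refine ⟨fun b hb => Eventually.of_forall fun k => hb.trans_le (norm_nonneg _), fun b hb => ?_⟩
  set ε := b / 2
  have hε : 0 < ε := by positivity
  have hfin : ∫⁻ x, ENNReal.ofReal (Φ |‖f.1 x‖ / ε|) ∂μ ≠ ∞ := by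
    have := modular_mul_lt_top hM h f (c := ε⁻¹) (by positivity)
    simpa only [orliczModular, div_eq_inv_mul] using this.ne
  have hlim : Tendsto (fun k => ∫⁻ x in (E k)ᶜ, ENNReal.ofReal (Φ |‖f.1 x‖ / ε|) ∂μ) atTop
      (𝓝 0) := by
    set ν := μ.withDensity fun x => ENNReal.ofReal (Φ |‖f.1 x‖ / ε|)
    have hν : ∀ k, ∫⁻ x in (E k)ᶜ, ENNReal.ofReal (Φ |‖f.1 x‖ / ε|) ∂μ = ν (E k)ᶜ := fun k =>
      (withDensity_apply _ (hE k).compl).symm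
    have : IsFiniteMeasure ν := isFiniteMeasure_withDensity hfin
    have := tendsto_measure_iInter_atTop (μ := ν) (s := fun k => (E k)ᶜ)
      (fun k => (hE k).compl.nullMeasurableSet)
      (fun i j hij => Set.compl_subset_compl.2 (hmono hij)) ⟨0, measure_ne_top _ _⟩
    simp only [hν]
    rwa [← Set.compl_iUnion, hun, Set.compl_univ, measure_empty] at this
  filter_upwards [hlim.eventually_lt_const one_pos] with k hk
  exact (norm_restrict_sub_le (hE k) f hε hk.le).trans_lt (half_lt_self hb)

/-- The functions vanishing off a compact set are dense. -/
lemma exists_compact_support_mem [TopologicalSpace α] [SigmaCompactSpace α] [T2Space α]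
    [OpensMeasurableSpace α] (hM : 0 < M) (h : ∀ t > 0, Φ (2 * t) ≤ M * Φ t)
    {U : Set (OrliczSpace Φ μ)} (hU : IsOpen U) (hne : U.Nonempty) :
    ∃ f ∈ U, ∃ K : Set α, IsCompact K ∧ ∀ᵐ x ∂μ, x ∉ K → f.1 x = 0 := by
  obtain ⟨f, hf⟩ := hne
  have hE := fun k => (isCompact_compactCovering α k).measurableSet
  obtain ⟨k, hk⟩ := ((tendsto_restrict_of_monotone hM h f hE
    (fun _ _ => fun hmn => compactCovering_subset α hmn)
    (iUnion_compactCovering α)).eventually_mem (hU.mem_nhds hf)).exists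
  refine ⟨_, hk, _, isCompact_compactCovering α k, ?_⟩
  filter_upwards [coeFn_restrict _ (hE k) f] with x hx hxK
  rw [hx, Set.indicator_of_notMem hxK]

/-- The indicator function of a set of finite measure. -/
noncomputable def indicatorOne (Φ : YoungFunction) {K : Set α} (hK : MeasurableSet K)
    (hμK : μ K ≠ ∞) : OrliczSpace Φ μ :=
  ⟨AEEqFun.mk (K.indicator fun _ => (1 : ℂ)) (aestronglyMeasurable_const.indicator hK), by
    refine ⟨1, one_pos, lt_of_le_of_lt (lintegral_mono_ae (g := K.indicator
      fun _ => ENNReal.ofReal (Φ 1)) ?_) ?_⟩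
    · filter_upwards [AEEqFun.coeFn_mk (μ := μ) (K.indicator fun _ => (1 : ℂ))
        (aestronglyMeasurable_const.indicator hK)] with x hx
      by_cases hxK : x ∈ K <;> simp [hx, hxK, Φ.zero']
    · rw [lintegral_indicator_const hK]
      exact ENNReal.mul_lt_top ENNReal.ofReal_lt_top hμK.lt_top⟩

lemma coeFn_indicatorOne {K : Set α} (hK : MeasurableSet K) (hμK : μ K ≠ ∞) :
    ∀ᵐ x ∂μ, (indicatorOne Φ hK hμK).1 x = K.indicator (fun _ => (1 : ℂ)) x :=
  AEEqFun.coeFn_mk _ (aestronglyMeasurable_const.indicator hK)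

lemma indicatorOne_ne_zero {K : Set α} (hK : MeasurableSet K) (hμK : μ K ≠ ∞) (h0 : 0 < μ K) :
    indicatorOne Φ hK hμK ≠ 0 := fun h => by
  refine h0.ne' (measure_mono_null (fun x hx => ?_)
    (ae_iff.1 ((coeFn_indicatorOne (Φ := Φ) hK hμK).and (AEEqFun.coeFn_zero (μ := μ) (β := ℂ)))))
  rintro ⟨h1, h2⟩
  rw [h] at h1
  have h3 : (0 : OrliczSpace Φ μ).1 x = 0 := h2
  simp [h3, hx] at h1

end OrliczSpace

/-! ### Powers of an aperiodic element -/

section Aperiodic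

variable {G : Type*} [Group G] [TopologicalSpace G] [IsTopologicalGroup G]

/-- If every neighbourhood of the identity contains a positive power of `a`, and the group is
locally compact, then the closed subgroup generated by `a` is compact. -/
lemma isCompact_topologicalClosure_zpowers [LocallyCompactSpace G] {a : G}
    (h : ∀ V ∈ 𝓝 (1 : G), ∃ m : ℕ, 0 < m ∧ a ^ m ∈ V) :
    IsCompact ((Subgroup.zpowers a).topologicalClosure : Set G) := by
  set H := (Subgroup.zpowers a).topologicalClosure with hH
  have haH : ∀ n : ℤ, a ^ n ∈ H := fun n =>
    Subgroup.le_topologicalClosure _ ⟨n, rfl⟩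
  have hcl : IsClosed (H : Set G) := Subgroup.isClosed_topologicalClosure _
  -- arbitrarily large powers
  have hlarge : ∀ N : ℕ, ∀ V ∈ 𝓝 (1 : G), ∃ m : ℕ, N < m ∧ a ^ m ∈ V := by
    intro N
    induction N with
    | zero => exact h
    | succ N ih =>
      intro V hV
      obtain ⟨W, hW, hWV⟩ := exists_nhds_one_split hV
      obtain ⟨m, hm, hmW⟩ := ih W hW
      obtain ⟨p, hp, hpW⟩ := h W hW
      exact ⟨m + p, by omega, by rw [pow_add]; exact hWV _ hmW _ hpW⟩
  -- every point of `H` is approximated by positive powers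
  have happ : ∀ x ∈ H, ∀ U ∈ 𝓝 x, ∃ m : ℕ, 0 < m ∧ a ^ m ∈ U := by
    intro x hx U hU
    obtain ⟨O, hOU, hO, hxO⟩ := mem_nhds_iff.1 hU
    obtain ⟨_, hyO, i, rfl⟩ := mem_closure_iff.1 (show x ∈ closure _ from hx) O hO hxO
    have hV : (fun y => a ^ i * y) ⁻¹' O ∈ 𝓝 (1 : G) :=
      (continuous_const.mul continuous_id).continuousAt.preimage_mem_nhds
        (by simpa using hO.mem_nhds hyO)
    obtain ⟨m, hm, hmV⟩ := hlarge i.natAbs _ hV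
    refine ⟨(i + m).toNat, by omega, hOU ?_⟩
    have : a ^ (i + m).toNat = a ^ i * a ^ m := by
      rw [← zpow_natCast, Int.toNat_of_nonneg (by omega), zpow_add, zpow_natCast]
    rw [this]; exact hmV
  obtain ⟨C, hC, hC1⟩ := exists_compact_mem_nhds (1 : G)
  obtain ⟨O, hOC, hO, h1O⟩ := mem_nhds_iff.1 hC1
  -- A positive power of `a` close to `x⁻¹` brings `x` close to 1.
  have hhit : ∀ x ∈ H, ∃ m : ℕ, 0 < m ∧ a ^ m * x ∈ O := by
    intro x hx
    have : (fun y => y * x) ⁻¹' O ∈ 𝓝 x⁻¹ :=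
      (continuous_id.mul continuous_const).continuousAt.preimage_mem_nhds
        (by simpa using hO.mem_nhds h1O)
    exact happ _ (H.inv_mem hx) _ this
  have hCH : IsCompact (C ∩ H) := hC.inter_right hcl
  -- Compactness makes the return time uniform: each point of `C ∩ H` is back in `O ⊆ C` within `N`
  -- steps.
  obtain ⟨t, ht⟩ := hCH.elim_finite_subcover
    (fun m : ℕ => {x | 0 < m ∧ a ^ m * x ∈ O}) (fun m => by
      by_cases hm : 0 < m
      · simp only [hm, true_and]
        exact hO.preimage (continuous_const.mul continuous_id : Continuous fun x => a ^ m * x)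
      · simp [hm]) (fun x hx => Set.mem_iUnion.2 (hhit x hx.2))
  set N := t.sup id
  have hret : ∀ x ∈ C ∩ H, ∃ m : ℕ, 0 < m ∧ m ≤ N ∧ a ^ m * x ∈ O := by
    intro x hx
    obtain ⟨m, hmt, hm⟩ := Set.mem_iUnion₂.1 (ht hx)
    exact ⟨m, hm.1, Finset.le_sup (f := id) hmt, hm.2⟩
  -- From `a^{-k} x` in `C`, successive returns raise the exponent by at most `N` each time while
  -- staying in `C`. The first positive exponent reached is thus at most `N`, so `H` is covered by
  -- the translates `a^{-j} C` with `j ≤ N`.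
  have hbound : ∀ k : ℕ, ∀ x ∈ H, a ^ (-(k : ℤ)) * x ∈ C →
      ∃ j ∈ Finset.range (N + 1), a ^ j * x ∈ C := by
    intro k
    induction k using Nat.strong_induction_on with
    | _ k ih =>
      intro x hx hk
      obtain ⟨m, hm0, hmN, hm⟩ := hret _ ⟨hk, H.mul_mem (haH _) hx⟩
      rw [← mul_assoc, ← zpow_natCast, ← zpow_add] at hm
      by_cases hmk : m ≤ k
      · refine ih (k - m) (by omega) x hx ?_
        rw [show (-((k - m : ℕ) : ℤ)) = m + -(k : ℤ) by push_cast [hmk]; ring]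
        exact hOC hm
      · refine ⟨m - k, Finset.mem_range.2 (by omega), ?_⟩
        rw [← zpow_natCast, show (((m - k : ℕ) : ℤ)) = m + -(k : ℤ) by
          push_cast [(not_le.1 hmk).le]; ring]
        exact hOC hm
  have hneg : ∀ x ∈ H, ∃ k : ℕ, a ^ (-(k : ℤ)) * x ∈ C := by
    intro x hx
    have : (fun y => y⁻¹ * x) ⁻¹' O ∈ 𝓝 x :=
      (continuous_inv.mul continuous_const).continuousAt.preimage_mem_nhds
        (by simpa using hO.mem_nhds h1O)
    obtain ⟨m, -, hm⟩ := happ x hx _ this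
    exact ⟨m, by rw [zpow_neg, zpow_natCast]; exact hOC hm⟩
  refine ((Finset.range (N + 1)).isCompact_biUnion
    (f := fun j => (fun y => (a ^ j)⁻¹ * y) '' C) fun j _ =>
      hC.image (continuous_const.mul continuous_id)).of_isClosed_subset hcl fun x hx => ?_
  obtain ⟨k, hk⟩ := hneg x hx
  obtain ⟨j, hj, hjC⟩ := hbound k x hx hk
  exact Set.mem_iUnion₂.2 ⟨j, hj, _, hjC, by simp⟩

/-- Large powers of an aperiodic element leave every compact set. -/
lemma IsAperiodic.eventually_pow_notMem [LocallyCompactSpace G] {a : G} (ha : IsAperiodic a)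
    {K : Set G} (hK : IsCompact K) : ∃ N : ℕ, ∀ n ≥ N, a ^ n ∉ K := by
  by_contra! hcon
  refine ha (isCompact_topologicalClosure_zpowers fun V hV => ?_)
  -- If infinitely many powers lay in `K` they would cluster at some `x`; quotients of two powers
  -- near `x` are positive powers of `a` near 1.
  obtain ⟨x, -, hx⟩ := hK.exists_mapClusterPt_of_frequently (l := atTop) (f := fun n : ℕ => a ^ n)
    (frequently_atTop.2 fun N => by simpa using hcon N)
  have hdiv : Tendsto (fun p : G × G => p.1⁻¹ * p.2) (𝓝 (x, x)) (𝓝 1) := by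
    have : Continuous fun p : G × G => p.1⁻¹ * p.2 := by fun_prop
    simpa using this.tendsto (x, x)
  rw [nhds_prod_eq] at hdiv
  obtain ⟨U, hU, hUV⟩ := Filter.mem_prod_same_iff.1 (hdiv hV)
  have hfr := mapClusterPt_iff_frequently.1 hx U hU
  obtain ⟨i, -, hi⟩ := frequently_atTop.1 hfr 0
  obtain ⟨j, hj, hjU⟩ := frequently_atTop.1 hfr (i + 1)
  refine ⟨j - i, by omega, ?_⟩
  have := hUV (Set.mk_mem_prod hi hjU)
  have he : a ^ (j - i) = (a ^ i)⁻¹ * a ^ j := by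
    rw [eq_inv_mul_iff_mul_eq, ← pow_add]; congr 1; omega
  rw [he]; exact this

/-- Large powers of an aperiodic element translate a compact set off itself. -/
lemma IsAperiodic.eventually_mul_pow_notMem [LocallyCompactSpace G] {a : G} (ha : IsAperiodic a)
    {K : Set G} (hK : IsCompact K) : ∃ N : ℕ, ∀ n ≥ N, ∀ x ∈ K, x * a ^ n ∉ K := by
  obtain ⟨N, hN⟩ := ha.eventually_pow_notMem (hK.inv.mul hK)
  refine ⟨N, fun n hn x hx hxa => hN n hn ?_⟩
  exact Set.mem_mul.2 ⟨x⁻¹, by simpa using hx, x * a ^ n, hxa, by group⟩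

end Aperiodic

/-- A continuous essentially bounded function is bounded. -/
lemma bddAbove_range_of_memLp_top {X : Type*} [TopologicalSpace X] [MeasurableSpace X]
    {μ : Measure X} [μ.IsOpenPosMeasure] {f : X → ℝ} (hf : Continuous f)
    (h : MemLp f ∞ μ) : BddAbove (Set.range f) := by
  refine ⟨(eLpNorm f ∞ μ).toReal, ?_⟩
  rintro _ ⟨x, rfl⟩
  by_contra! hx
  -- The set where `f` exceeds its essential bound is open and null, hence empty because `μ` charges
  -- nonempty open sets.
  have hopen : IsOpen {y | (eLpNorm f ∞ μ).toReal < f y} := isOpen_lt continuous_const hf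
  refine (hopen.measure_pos μ ⟨x, hx⟩).ne' (measure_mono_null (fun y hy => ?_)
    (ae_iff.1 (ae_le_eLpNormEssSup (f := f) (μ := μ))))
  rw [← eLpNorm_exponent_top]
  intro hle
  have := ENNReal.toReal_mono h.2.ne hle
  rw [toReal_enorm] at this
  exact absurd (this.trans_lt hy) (not_lt.2 (le_abs_self _))

/-! ### Iterates and inverse of the weighted translation -/

section Translation

variable {G : Type*} [Group G] [TopologicalSpace G]

lemma weightProd_pos (w : Weight G) (a : G) (n : ℕ) (x : G) : 0 < weightProd w a n x :=
  Finset.prod_pos fun _ _ => w.pos' _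

lemma weightProdTilde_pos (w : Weight G) (a : G) (n : ℕ) (x : G) : 0 < weightProdTilde w a n x :=
  inv_pos.2 (Finset.prod_pos fun _ _ => w.pos' _)

variable [IsTopologicalGroup G]

/-- The weight `x ↦ (w (x a))⁻¹` of the inverse weighted translation. -/
noncomputable def Weight.inverse (w : Weight G) (a : G)
    (h : BddAbove (Set.range fun x => (w x)⁻¹)) : Weight G where
  toFun x := (w (x * a))⁻¹
  continuous' := (w.continuous'.comp (continuous_mul_const a)).inv₀ fun x => (w.pos' _).ne'
  pos' x := inv_pos.2 (w.pos' _)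
  bddAbove' := h.mono (by rintro _ ⟨x, rfl⟩; exact ⟨x * a, rfl⟩)

/-- The `j`-th factor is `w(x a^{-j} a)⁻¹ = w(x a^{-(j-1)})⁻¹`, which accounts for the index shift
between the two products. Through this identity each result on `T` and `φ_n` yields one on `S` and
`φ̃_n`. -/
lemma weightProd_inverse (w : Weight G) (a : G) (h : BddAbove (Set.range fun x => (w x)⁻¹))
    (n : ℕ) : weightProd (w.inverse a h) a⁻¹ n = weightProdTilde w a n := by
  funext x
  unfold weightProd weightProdTilde
  induction n with
  | zero => simp
  | succ n ih =>
    rw [Finset.prod_Icc_succ_top (by omega), ih, Finset.prod_range_succ, mul_inv]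
    congr 2
    change (w (x * a⁻¹ ^ (n + 1) * a))⁻¹ = _
    rw [pow_succ, inv_pow, ← mul_assoc, inv_mul_cancel_right]


variable [MeasurableSpace G] [BorelSpace G] {Φ : YoungFunction} {μ : Measure G} [μ.IsMulRightInvariant]

lemma coeFn_weightedTranslation (a : G) (w : Weight G) (f : OrliczSpace Φ μ) :
    ∀ᵐ x ∂μ, (weightedTranslation Φ μ a w f).1 x = w x * f.1 (x * a⁻¹) :=
  coeFn_weightedTranslationAux μ a w f.1

lemma ae_mul_right {p : G → Prop} (h : ∀ᵐ x ∂μ, p x) (b : G) : ∀ᵐ x ∂μ, p (x * b) :=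
  (measurePreserving_mul_right μ b).quasiMeasurePreserving.ae h

/-- Evaluation at `x * a ^ n` undoes the translation, leaving a multiplication operator. -/
lemma coeFn_weightedTranslation_pow (a : G) (w : Weight G) (n : ℕ) (f : OrliczSpace Φ μ) :
    ∀ᵐ x ∂μ, ((weightedTranslation Φ μ a w ^ n) f).1 (x * a ^ n) = weightProd w a n x * f.1 x := by
  induction n with
  | zero => simp [weightProd]
  | succ n ih =>
    filter_upwards [ih, ae_mul_right (coeFn_weightedTranslation a w
      ((weightedTranslation Φ μ a w ^ n) f)) (a ^ (n + 1))] with x h1 h2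
    rw [pow_succ' (weightedTranslation Φ μ a w), mul_apply_eq_comp, h2,
      pow_succ a, ← mul_assoc, mul_inv_cancel_right, h1, weightProd, weightProd,
      Finset.prod_Icc_succ_top (by omega), pow_succ, mul_assoc x]
    push_cast
    ring

lemma norm_weightedTranslation_pow_le (a : G) (w : Weight G) (n : ℕ) (f : OrliczSpace Φ μ)
    {C : ℝ} (hC : 0 ≤ C) (h : ∀ᵐ x ∂μ, f.1 x ≠ 0 → weightProd w a n x ≤ C) :
    ‖(weightedTranslation Φ μ a w ^ n) f‖ ≤ C * ‖f‖ := by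
  refine OrliczSpace.norm_le_of_forall _ _ hC fun k hk D hD => ?_
  have hk0 := hk.1
  have hD0 : 0 < D := hC.trans_lt hD
  refine ⟨by positivity, ?_⟩
  -- Translating by `a^{-n}` turns the modular of `T^n f` into that of `φ_n f`.
  rw [← orliczModular_translate Φ μ (a ^ n)⁻¹]
  refine (orliczModular_mono Φ ?_).trans hk.2
  filter_upwards [h, coeFn_weightedTranslation_pow a w n f] with x hx hx'
  rw [inv_inv, hx', norm_mul, Complex.norm_real, Real.norm_of_nonneg (weightProd_pos w a n x).le]
  have hp := (weightProd_pos w a n x).le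
  rw [abs_of_nonneg (by positivity), abs_of_nonneg (by positivity),
    div_le_div_iff₀ (by positivity) hk0]
  rcases eq_or_ne (f.1 x) 0 with h0 | h0
  · simp [h0]
  · calc weightProd w a n x * ‖f.1 x‖ * k ≤ D * ‖f.1 x‖ * k := by
          gcongr; exact (hx h0).trans hD.le
      _ = _ := by ring

variable (w : Weight G) (a : G) (h : BddAbove (Set.range fun x => (w x)⁻¹))

lemma weightedTranslation_mul_inverse :
    weightedTranslation Φ μ a w * weightedTranslation Φ μ a⁻¹ (w.inverse a h) = 1 := by
  ext1 f
  refine Subtype.ext (AEEqFun.ext ?_)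
  filter_upwards [coeFn_weightedTranslation a w (weightedTranslation Φ μ a⁻¹ (w.inverse a h) f),
    ae_mul_right (coeFn_weightedTranslation a⁻¹ (w.inverse a h) f) a⁻¹] with x h1 h2
  rw [mul_apply_eq_comp, h1, h2]
  have := (w.pos' x).ne'
  simp [Weight.inverse, this]

lemma inverse_mul_weightedTranslation :
    weightedTranslation Φ μ a⁻¹ (w.inverse a h) * weightedTranslation Φ μ a w = 1 := by
  ext1 f
  refine Subtype.ext (AEEqFun.ext ?_)
  filter_upwards [coeFn_weightedTranslation a⁻¹ (w.inverse a h) (weightedTranslation Φ μ a w f),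
    ae_mul_right (coeFn_weightedTranslation a w f) a] with x h1 h2
  rw [mul_apply_eq_comp, h1, inv_inv, h2]
  have := (w.pos' (x * a)).ne'
  simp [Weight.inverse, this]

end Translation

/-! ### From small weight products to small iterates -/

section Sufficiency

variable {G : Type*} [Group G] [TopologicalSpace G] [IsTopologicalGroup G]
  [MeasurableSpace G] [BorelSpace G] {Φ : YoungFunction} {μ : Measure G} [μ.IsMulRightInvariant]

lemma tendsto_weightedTranslation_pow_restrict (a : G) (w : Weight G) (f : OrliczSpace Φ μ)
    {E : ℕ → Set G} (hE : ∀ k, MeasurableSet (E k)) (m : ℕ → ℕ)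
    (h : Tendsto (fun k => eLpNorm (weightProd w a (m k)) ∞ (μ.restrict (E k))) atTop (𝓝 0)) :
    Tendsto (fun k => (weightedTranslation Φ μ a w ^ m k) (f.restrict (E k) (hE k))) atTop
      (𝓝 0) := by
  have h' : Tendsto (fun k => (eLpNorm (weightProd w a (m k)) ∞ (μ.restrict (E k))).toReal * ‖f‖)
      atTop (𝓝 0) := by
    simpa using ((ENNReal.tendsto_toReal ENNReal.zero_ne_top).comp h).mul_const ‖f‖
  refine squeeze_zero_norm' ?_ h'
  -- Finiteness is needed because `toReal` sends `∞` to 0 and would then give no bound.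
  filter_upwards [h.eventually_lt_const ENNReal.zero_lt_top] with k hk
  refine (norm_weightedTranslation_pow_le a w (m k) _ ENNReal.toReal_nonneg ?_).trans
    (mul_le_mul_of_nonneg_left (f.norm_restrict_le (E k) (hE k)) ENNReal.toReal_nonneg)
  have hb := ae_le_eLpNormEssSup (f := weightProd w a (m k)) (μ := μ.restrict (E k))
  rw [← eLpNorm_exponent_top, ae_restrict_iff' (hE k)] at hb
  filter_upwards [hb, f.coeFn_restrict (E k) (hE k)] with x hx hx' hne
  have hxE : x ∈ E k := by
    by_contra hxE
    exact hne (by rw [hx', Set.indicator_of_notMem hxE])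
  have := ENNReal.toReal_mono hk.ne (hx hxE)
  rw [toReal_enorm] at this
  exact (le_abs_self _).trans this

end Sufficiency

/-! ### From returning orbits to small weight products -/

section Necessity

variable {G : Type*} [Group G] [TopologicalSpace G] [IsTopologicalGroup G]
  [MeasurableSpace G] [BorelSpace G] {Φ : YoungFunction} {μ : Measure G} [μ.IsMulRightInvariant]

/-- If `f` is large on `K` and `T^n f` is small off `K`, and `K a^n` is disjoint from `K`, then
`φ_n` is small on `K`, up to exceptional sets. -/
lemma weightProd_le_of_translate_small (a : G) (w : Weight G) (n : ℕ) (f g : OrliczSpace Φ μ)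
    (hg : (weightedTranslation Φ μ a w ^ n) f = g) {K D D' : Set G} {η : ℝ}
    (hf : ∀ᵐ x ∂μ, x ∈ K → x ∉ D → 1 / 2 ≤ ‖f.1 x‖)
    (hg' : ∀ᵐ x ∂μ, x ∉ K → x ∉ D' → ‖g.1 x‖ ≤ η) (hK : ∀ x ∈ K, x * a ^ n ∉ K) :
    ∀ᵐ x ∂μ, x ∈ K → x ∉ D → x * a ^ n ∉ D' → weightProd w a n x ≤ 2 * η := by
  subst hg
  filter_upwards [hf, ae_mul_right hg' (a ^ n), coeFn_weightedTranslation_pow a w n f]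
    with x h1 h2 h3 hxK hxD hxD'
  have h4 := h2 (hK x hxK) hxD'
  have hp := weightProd_pos w a n x
  rw [h3, norm_mul, Complex.norm_real, Real.norm_of_nonneg hp.le] at h4
  have h5 := h1 hxK hxD
  nlinarith

/-- If finitely many iterates of `f` are all large on `K` and small off `K`, up to sets of small
measure, then the weight products between them are small on most of `K`. -/
lemma exists_subset_weightProd_le {ι : Type*} [Fintype ι] (w : Weight G) (a : G)
    (h : BddAbove (Set.range fun x => (w x)⁻¹)) (R : ι → ℕ) (n : ℕ) (f : OrliczSpace Φ μ)
    {K : Set G} (hK : MeasurableSet K) {N : ℕ} (hN : ∀ m ≥ N, ∀ x ∈ K, x * a ^ m ∉ K)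
    (hn : N ≤ n) {η : ℝ} {ε : ℝ≥0∞} (D : ι → Set G) (hD : ∀ i, MeasurableSet (D i))
    (hDε : ∀ i, μ (D i) ≤ ε)
    (hlarge : ∀ i, ∀ᵐ x ∂μ, x ∈ K → x ∉ D i →
      1 / 2 ≤ ‖((weightedTranslation Φ μ a w ^ (R i * n)) f).1 x‖)
    (hsmall : ∀ i, ∀ᵐ x ∂μ, x ∉ K → x ∉ D i →
      ‖((weightedTranslation Φ μ a w ^ (R i * n)) f).1 x‖ ≤ η) :
    ∃ E, MeasurableSet E ∧ E ⊆ K ∧ μ (K \ E) ≤ Fintype.card ι * (Fintype.card ι * (4 * ε)) ∧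
      ∀ i j, R i < R j →
        (∀ᵐ x ∂μ, x ∈ E → weightProd w a ((R j - R i) * n) x ≤ 2 * η) ∧
        (∀ᵐ x ∂μ, x ∈ E → weightProdTilde w a ((R j - R i) * n) x ≤ 2 * η) := by
  -- The first pair holds the exceptional points for `T^m` from the `i`-th iterate to the `j`-th, `m
  -- = (R j - R i) * n`; the second those for `S^m` going back. Right invariance bounds each of the
  -- four sets by `ε`.
  set B : ι → ι → Set G := fun i j =>
    (D i ∪ (fun x => x * a ^ ((R j - R i) * n)) ⁻¹' D j) ∪
    (D j ∪ (fun x => x * a⁻¹ ^ ((R j - R i) * n)) ⁻¹' D i) with hB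
  have hBm : ∀ i j, MeasurableSet (B i j) := fun i j =>
    ((hD i).union (measurable_mul_const _ (hD j))).union
      ((hD j).union (measurable_mul_const _ (hD i)))
  have hBμ : ∀ i j, μ (B i j) ≤ 4 * ε := fun i j => by
    calc μ (B i j) ≤ (ε + ε) + (ε + ε) := by
          refine (measure_union_le _ _).trans (add_le_add
            ((measure_union_le _ _).trans (add_le_add (hDε i) ?_))
            ((measure_union_le _ _).trans (add_le_add (hDε j) ?_)))
          · rw [measure_preimage_mul_right]; exact hDε j
          · rw [measure_preimage_mul_right]; exact hDε i
      _ = 4 * ε := by ring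
  refine ⟨K \ ⋃ i, ⋃ j, B i j, hK.diff (.iUnion fun i => .iUnion fun j => hBm i j),
    Set.sdiff_subset, ?_, fun i j hij => ?_⟩
  · calc μ (K \ (K \ ⋃ i, ⋃ j, B i j)) ≤ μ (⋃ i, ⋃ j, B i j) :=
          measure_mono (by rw [Set.sdiff_sdiff_right_self]; exact Set.inter_subset_right)
      _ ≤ ∑ i, ∑ j, μ (B i j) := (measure_iUnion_fintype_le _ _).trans
          (Finset.sum_le_sum fun i _ => measure_iUnion_fintype_le _ _)
      _ ≤ ∑ _i : ι, ∑ _j : ι, 4 * ε :=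
          Finset.sum_le_sum fun i _ => Finset.sum_le_sum fun j _ => hBμ i j
      _ = _ := by simp
  · have hB' : ∀ x ∈ K \ ⋃ i, ⋃ j, B i j, x ∈ K ∧ x ∉ B i j := fun x hx =>
      ⟨hx.1, fun hxB => hx.2 (Set.mem_iUnion₂.2 ⟨i, j, hxB⟩)⟩
    set m := (R j - R i) * n with hm
    have hmN : N ≤ m := hn.trans (Nat.le_mul_of_pos_left n (by omega))
    have hT : (weightedTranslation Φ μ a w ^ m) ((weightedTranslation Φ μ a w ^ (R i * n)) f) =
        (weightedTranslation Φ μ a w ^ (R j * n)) f := by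
      rw [← mul_apply_eq_comp, ← pow_add, hm, ← add_mul, Nat.sub_add_cancel hij.le]
    have hS : (weightedTranslation Φ μ a⁻¹ (w.inverse a h) ^ m)
        ((weightedTranslation Φ μ a w ^ (R j * n)) f) =
        (weightedTranslation Φ μ a w ^ (R i * n)) f := by
      rw [← hT, ← mul_apply_eq_comp,
        pow_mul_pow_eq_one m (inverse_mul_weightedTranslation w a h), one_apply_eq_self]
    constructor
    · filter_upwards [weightProd_le_of_translate_small a w m _ _ hT (hlarge i) (hsmall j)
        (hN m hmN)] with x hx hxE
      obtain ⟨hxK, hxB⟩ := hB' x hxE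
      simp only [hB, Set.mem_union, Set.mem_preimage, not_or] at hxB
      exact hx hxK hxB.1.1 hxB.1.2
    · rw [← weightProd_inverse w a h]
      filter_upwards [weightProd_le_of_translate_small a⁻¹ (w.inverse a h) m _ _ hS (hlarge j)
        (hsmall i) (fun x hx hxa => hN m hmN _ hxa (by simpa using hx))] with x hx hxE
      obtain ⟨hxK, hxB⟩ := hB' x hxE
      simp only [hB, Set.mem_union, Set.mem_preimage, not_or] at hxB
      exact hx hxK hxB.2.1 hxB.2.2

/-- Disjoint transitivity provides arbitrarily large times at which the iterates of a function
close to `1_K` return close to a multiple of `1_K`. -/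
lemma DisjointTransitive.exists_large_return {X : Type*} [NormedAddCommGroup X] [NormedSpace ℂ X]
    {L : ℕ} {T : Fin L → X →L[ℂ] X} (hT : DisjointTransitive T) (l₀ : Fin L) {u : X} (hu : u ≠ 0)
    (N : ℕ) {δ : ℝ} (hδ : 0 < δ) :
    ∃ n > N, ∃ C : ℝ, 1 ≤ C ∧ ∃ f, ‖f - u‖ < δ ∧ ∀ l, ‖(T l ^ n) f - (C : ℂ) • u‖ < δ := by
  set M := ∑ n ∈ Finset.range (N + 1), ‖T l₀ ^ n‖
  have hM0 : 0 ≤ M := Finset.sum_nonneg fun _ _ => norm_nonneg _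
  have hu' : 0 < ‖u‖ := norm_pos_iff.2 hu
  -- If `n ≤ N`, then `‖T l₀ ^ n f‖ ≤ M (‖u‖ + δ)`, whereas `C ‖u‖ - δ` equals `‖u‖ + M (‖u‖ + δ)`.
  -- This `C` puts the target out of reach at such times.
  set C := 1 + (M * (‖u‖ + δ) + δ) / ‖u‖ with hC
  have hCu : C * ‖u‖ = ‖u‖ + (M * (‖u‖ + δ) + δ) := by rw [hC]; field_simp
  have hC1 : 1 ≤ C := le_add_of_nonneg_right (by positivity)
  obtain ⟨n, hn0, f, hfU, hfV⟩ := hT (Metric.ball u δ) (fun _ => Metric.ball ((C : ℂ) • u) δ)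
    Metric.isOpen_ball ⟨u, Metric.mem_ball_self hδ⟩ (fun _ => Metric.isOpen_ball)
    (fun _ => ⟨_, Metric.mem_ball_self hδ⟩)
  have hf : ‖f - u‖ < δ := by simpa [dist_eq_norm] using hfU
  have hV : ∀ l, ‖(T l ^ n) f - (C : ℂ) • u‖ < δ := fun l => by
    simpa [dist_eq_norm] using Set.mem_iInter.1 hfV l
  refine ⟨n, ?_, C, hC1, f, hf, hV⟩
  by_contra! hnN
  have h1 : ‖T l₀ ^ n‖ ≤ M := Finset.single_le_sum (f := fun n => ‖T l₀ ^ n‖)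
    (fun _ _ => norm_nonneg _) (Finset.mem_range.2 (by omega))
  have h2 : ‖f‖ ≤ ‖u‖ + δ := by
    have := norm_sub_norm_le f u; linarith
  have h3 : ‖(T l₀ ^ n) f‖ ≤ M * (‖u‖ + δ) :=
    ((T l₀ ^ n).le_opNorm f).trans (mul_le_mul h1 h2 (norm_nonneg _) hM0)
  have h4 : ‖(C : ℂ) • u‖ - ‖(T l₀ ^ n) f‖ < δ :=
    (norm_sub_norm_le _ _).trans_lt (by rw [norm_sub_rev]; exact hV l₀)
  rw [norm_smul, Complex.norm_real, Real.norm_of_nonneg (by linarith), hCu] at h4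
  linarith

/-- Both families of conditions become one when exponent 0, standing for `f` itself, is adjoined to
the `r l`: every product needed then has exponent `(R j - R i) * n` with `R i < R j`. -/
lemma DisjointTransitive.exists_time_subset_weightProd_le [LocallyCompactSpace G] [T2Space G]
    [IsFiniteMeasureOnCompacts μ]
    {a : G} (ha : IsAperiodic a) {w : Weight G} (h : BddAbove (Set.range fun x => (w x)⁻¹))
    {L : ℕ} (l₀ : Fin L) {r : Fin L → ℕ} (hr_pos : ∀ l, 1 ≤ r l) (hr : StrictMono r)
    (hT : DisjointTransitive (fun l => weightedTranslation Φ μ a w ^ r l))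
    {K : Set G} (hK : IsCompact K) (hμK : 0 < μ K) {ε : ℝ} (hε : 0 < ε) (N : ℕ) :
    ∃ n > N, ∃ E, MeasurableSet E ∧ E ⊆ K ∧ μ (K \ E) ≤ ENNReal.ofReal ε ∧
      (∀ l, (∀ᵐ x ∂μ, x ∈ E → weightProd w a (r l * n) x ≤ ε) ∧
        (∀ᵐ x ∂μ, x ∈ E → weightProdTilde w a (r l * n) x ≤ ε)) ∧
      ∀ s l, s < l → (∀ᵐ x ∂μ, x ∈ E → weightProd w a ((r l - r s) * n) x ≤ ε) ∧
        (∀ᵐ x ∂μ, x ∈ E → weightProdTilde w a ((r l - r s) * n) x ≤ ε) := by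
  obtain ⟨N₀, hN₀⟩ := ha.eventually_mul_pow_notMem hK
  set c := Fintype.card (Option (Fin L)) with hc
  have hc0 : (0 : ℝ) < c := Nat.cast_pos.2 Fintype.card_pos
  -- Here `η ≤ 1/2` keeps the iterates at least `1/2` on `K`, and `2 η ≤ ε` gives the final bound.
  -- The choice of `ε'` makes the total exceptional measure `c * (c * (4 * ε'))` equal to `ε`.
  set η : ℝ := min (ε / 2) (1 / 2)
  have hη : 0 < η := by positivity
  set ε' : ℝ := ε / (4 * c ^ 2)
  have hε' : 0 < ε' := by positivity
  obtain ⟨δ, hδ, hδm⟩ := OrliczSpace.exists_measure_le_of_norm_lt Φ μ hη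
    (ENNReal.ofReal_pos.2 hε').ne'
  set u := OrliczSpace.indicatorOne (μ := μ) Φ hK.measurableSet hK.measure_ne_top
  have hu : u ≠ 0 := OrliczSpace.indicatorOne_ne_zero hK.measurableSet hK.measure_ne_top hμK
  obtain ⟨n, hn, C, hC, f, hf, hfV⟩ := hT.exists_large_return l₀ hu (max N N₀) hδ
  let R : Option (Fin L) → ℕ := fun i => i.elim 0 r
  let b : Option (Fin L) → ℝ := fun i => i.elim 1 fun _ => C
  have hb1 : ∀ i, 1 ≤ b i := by rintro (_ | l) <;> simp [b, hC]
  let g : Option (Fin L) → OrliczSpace Φ μ := fun i =>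
    (weightedTranslation Φ μ a w ^ (R i * n)) f - (b i : ℂ) • u
  have hg : ∀ i, ‖g i‖ < δ := by
    rintro (_ | l)
    · simpa [g, R, b] using hf
    · simpa [g, R, b, pow_mul] using hfV l
  have hfg : ∀ i, ∀ᵐ x ∂μ, (g i).1 x = ((weightedTranslation Φ μ a w ^ (R i * n)) f).1 x -
      b i * K.indicator (fun _ => (1 : ℂ)) x := fun i => by
    filter_upwards [OrliczSpace.coeFn_sub ((weightedTranslation Φ μ a w ^ (R i * n)) f)
      ((b i : ℂ) • u), OrliczSpace.coeFn_smul (b i : ℂ) u,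
      OrliczSpace.coeFn_indicatorOne (Φ := Φ) hK.measurableSet hK.measure_ne_top] with x h1 h2 h3
    rw [← h3, h1, h2]
  obtain ⟨E, hEm, hEK, hEμ, hE⟩ := exists_subset_weightProd_le w a h R n f hK.measurableSet
    hN₀ ((le_max_right _ _).trans hn.le) (η := η) (fun i => {x | η ≤ ‖(g i).1 x‖})
    (fun i => measurableSet_le measurable_const (g i).1.measurable.norm) (fun i => hδm _ (hg i))
    (fun i => by
      filter_upwards [hfg i] with x hx hxK hxD
      simp only [not_le, hx, hxK, Set.indicator_of_mem, mul_one] at hxD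
      have h1 := norm_sub_norm_le (b i : ℂ) (((weightedTranslation Φ μ a w ^ (R i * n)) f).1 x)
      rw [norm_sub_rev, Complex.norm_real, Real.norm_of_nonneg (zero_le_one.trans (hb1 i))] at h1
      have h2 : η ≤ 1 / 2 := min_le_right _ _
      linarith [hb1 i])
    (fun i => by
      filter_upwards [hfg i] with x hx hxK hxD
      simp only [not_le, hx, hxK, Set.indicator_of_notMem, not_false_eq_true,
        mul_zero, sub_zero] at hxD
      exact hxD.le)
  have h2η : 2 * η ≤ ε := by linarith [min_le_left (ε / 2) (1 / 2 : ℝ)]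
  have hE' : ∀ i j, R i < R j →
      (∀ᵐ x ∂μ, x ∈ E → weightProd w a ((R j - R i) * n) x ≤ ε) ∧
      (∀ᵐ x ∂μ, x ∈ E → weightProdTilde w a ((R j - R i) * n) x ≤ ε) := fun i j hij =>
    ⟨(hE i j hij).1.mono fun x hx hxE => (hx hxE).trans h2η,
      (hE i j hij).2.mono fun x hx hxE => (hx hxE).trans h2η⟩
  refine ⟨n, (le_max_left _ _).trans_lt hn, E, hEm, hEK, hEμ.trans (le_of_eq ?_), fun l => ?_,
    fun s l hsl => hE' (some s) (some l) (hr hsl)⟩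
  · rw [← hc, ← ENNReal.ofReal_natCast, show (4 : ℝ≥0∞) = ENNReal.ofReal 4 by simp,
      ← ENNReal.ofReal_mul (by positivity), ← ENNReal.ofReal_mul (by positivity),
      ← ENNReal.ofReal_mul (by positivity)]
    congr 1
    simp only [ε']
    field_simp
  · simpa [R] using hE' none (some l) (hr_pos l)

end Necessity

/-! ### The equivalence -/

lemma tendsto_eLpNorm_top_restrict_zero {α : Type*} [MeasurableSpace α] {μ : Measure α}
    {E : ℕ → Set α} (hE : ∀ k, MeasurableSet (E k)) {f : ℕ → α → ℝ} (hf0 : ∀ k x, 0 ≤ f k x)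
    {ε : ℕ → ℝ} (hε : Tendsto ε atTop (𝓝 0)) (h : ∀ k, ∀ᵐ x ∂μ, x ∈ E k → f k x ≤ ε k) :
    Tendsto (fun k => eLpNorm (f k) ∞ (μ.restrict (E k))) atTop (𝓝 0) := by
  refine tendsto_of_tendsto_of_tendsto_of_le_of_le tendsto_const_nhds
    (by simpa using ENNReal.tendsto_ofReal hε) (fun _ => zero_le) fun k => ?_
  rw [eLpNorm_exponent_top]
  refine eLpNormEssSup_le_of_ae_bound ((ae_restrict_iff' (hE k)).2 ?_)
  filter_upwards [h k] with x hx hxE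
  rw [Real.norm_of_nonneg (hf0 k x)]
  exact hx hxE

theorem corollary2p4 {G : Type*} [Group G] [TopologicalSpace G] [IsTopologicalGroup G]
    [T2Space G] [LocallyCompactSpace G] [SecondCountableTopology G]
    [MeasurableSpace G] [BorelSpace G]
    -- a right Haar measure on `G`
    (μ : Measure G) [IsFiniteMeasureOnCompacts μ] [μ.IsOpenPosMeasure] [μ.IsMulRightInvariant]
    (Φ : YoungFunction) (hΦ : Φ.IsDelta2Regular G)
    (a : G) (ha : IsAperiodic a)
    (w : Weight G) (hw : MemLp (fun x => (w x)⁻¹) ∞ μ)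
    (L : ℕ) (hL : 2 ≤ L) (r : Fin L → ℕ) (hr_pos : ∀ l, 1 ≤ r l) (hr : StrictMono r) :
    DisjointTransitive (fun l => weightedTranslation Φ μ a w ^ r l) ↔
      ∀ K : Set G, IsCompact K → 0 < μ K →
        ∃ (E : ℕ → Set G) (n : ℕ → ℕ),
          (∀ k, MeasurableSet (E k) ∧ E k ⊆ K) ∧
          Tendsto (fun k => μ (E k)) atTop (𝓝 (μ K)) ∧
          StrictMono n ∧
          (∀ l,
            Tendsto (fun k => eLpNorm (weightProd w a (r l * n k)) ∞ (μ.restrict (E k)))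
              atTop (𝓝 0) ∧
            Tendsto (fun k => eLpNorm (weightProdTilde w a (r l * n k)) ∞ (μ.restrict (E k)))
              atTop (𝓝 0)) ∧
          (∀ s l, s < l →
            Tendsto (fun k => eLpNorm (weightProdTilde w a ((r l - r s) * n k)) ∞
              (μ.restrict (E k))) atTop (𝓝 0) ∧
            Tendsto (fun k => eLpNorm (weightProd w a ((r l - r s) * n k)) ∞
              (μ.restrict (E k))) atTop (𝓝 0)) := by
  -- In a compact group the closed subgroup generated by `a` would be compact.
  obtain ⟨M, hM, hΔ⟩ := hΦ.2 fun hG => ha (Subgroup.isClosed_topologicalClosure _).isCompact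
  have hwb : BddAbove (Set.range fun x => (w x)⁻¹) := bddAbove_range_of_memLp_top
    (w.continuous'.inv₀ fun x => (w.pos' x).ne') hw
  set T := weightedTranslation Φ μ a w with hT
  set S := weightedTranslation Φ μ a⁻¹ (w.inverse a hwb) with hS
  have hTS : ∀ n, T ^ n * S ^ n = 1 := fun n =>
    pow_mul_pow_eq_one n (weightedTranslation_mul_inverse w a hwb)
  constructor
  · intro hDT K hK hμK
    have step : ∀ k N : ℕ, _ := fun k N => hDT.exists_time_subset_weightProd_le ha hwb
      ⟨0, by omega⟩ hr_pos hr hK hμK (Nat.one_div_pos_of_nat (α := ℝ) (n := k)) N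
    choose F hF E hEm hEK hEμ hE1 hE2 using step
    -- Each time is chosen beyond the previous one, with error `1/(k+1)` at stage `k`. The value `p
    -- 0 = 0` is only a seed: the `k`-th time is `p (k + 1)`.
    let p : ℕ → ℕ := fun k => Nat.rec 0 (fun k prev => F k prev) k
    have hp : ∀ k, p (k + 1) = F k (p k) := fun _ => rfl
    have hε := tendsto_one_div_add_atTop_nhds_zero_nat (𝕜 := ℝ)
    have hlim : ∀ {f : ℕ → G → ℝ}, (∀ k x, 0 < f k x) →
        (∀ k, ∀ᵐ x ∂μ, x ∈ E k (p k) → f k x ≤ 1 / ((k : ℝ) + 1)) →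
        Tendsto (fun k => eLpNorm (f k) ∞ (μ.restrict (E k (p k)))) atTop (𝓝 0) :=
      fun hf h => tendsto_eLpNorm_top_restrict_zero (fun k => hEm k _) (fun k x => (hf k x).le) hε h
    refine ⟨fun k => E k (p k), fun k => p (k + 1), fun k => ⟨hEm k _, hEK k _⟩, ?_,
      strictMono_nat_of_lt_succ fun k => hF (k + 1) (p (k + 1)), fun l => ⟨?_, ?_⟩,
      fun s l hsl => ⟨?_, ?_⟩⟩
    · have h1 : Tendsto (fun k : ℕ => μ K - ENNReal.ofReal (1 / ((k : ℝ) + 1))) atTop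
          (𝓝 (μ K)) := by
        simpa using ENNReal.Tendsto.sub (tendsto_const_nhds (x := μ K))
          (ENNReal.tendsto_ofReal hε) (Or.inl hK.measure_ne_top)
      refine tendsto_of_tendsto_of_tendsto_of_le_of_le h1 tendsto_const_nhds (fun k => ?_)
        fun k => measure_mono (hEK k _)
      refine tsub_le_iff_right.2 ((tsub_le_iff_left.1 (le_measure_sdiff
        (s₁ := K) (s₂ := E k (p k)))).trans ?_)
      gcongr
      exact hEμ k _
    · exact hlim (fun k x => weightProd_pos w a _ x) fun k => (hE1 k (p k) l).1
    · exact hlim (fun k x => weightProdTilde_pos w a _ x) fun k => (hE1 k (p k) l).2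
    · exact hlim (fun k x => weightProdTilde_pos w a _ x) fun k => (hE2 k (p k) s l hsl).2
    · exact hlim (fun k x => weightProd_pos w a _ x) fun k => (hE2 k (p k) s l hsl).1
  · intro hcond U V hU hUne hV hVne
    obtain ⟨f, hfU, K₀, hK₀, hf⟩ := OrliczSpace.exists_compact_support_mem hM hΔ hU hUne
    choose g hgV K₁ hK₁ hg using fun l =>
      OrliczSpace.exists_compact_support_mem hM hΔ (hV l) (hVne l)
    -- A compact neighbourhood of 1 is added to the supports so that `K` has positive measure.
    obtain ⟨C, hC, hC1⟩ := exists_compact_mem_nhds (1 : G)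
    set K := C ∪ (K₀ ∪ ⋃ l, K₁ l)
    have hK : IsCompact K := hC.union (hK₀.union (isCompact_iUnion hK₁))
    have hfK : ∀ᵐ x ∂μ, x ∉ K → f.1 x = 0 := hf.mono fun x hx hxK =>
      hx fun h => hxK (Or.inr (Or.inl h))
    have hgK : ∀ l, ∀ᵐ x ∂μ, x ∉ K → (g l).1 x = 0 := fun l => (hg l).mono fun x hx hxK =>
      hx fun h => hxK (Or.inr (Or.inr (Set.mem_iUnion.2 ⟨l, h⟩)))
    obtain ⟨E, n, hE, hEμ, hn, h1, h2⟩ := hcond K hK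
      ((Measure.measure_pos_of_mem_nhds μ hC1).trans_le (measure_mono Set.subset_union_left))
    have hEm := fun k => (hE k).1
    have hfE := OrliczSpace.tendsto_restrict hM hΔ f hK.measurableSet hK.measure_ne_top hfK hEm
      (fun k => (hE k).2) hEμ
    have hgE := fun l => OrliczSpace.tendsto_restrict hM hΔ (g l) hK.measurableSet
      hK.measure_ne_top (hgK l) hEm (fun k => (hE k).2) hEμ
    have hTE := fun (f : OrliczSpace Φ μ) (m : ℕ → ℕ) =>
      tendsto_weightedTranslation_pow_restrict a w f hEm m
    have hSE := fun (f : OrliczSpace Φ μ) (m : ℕ → ℕ) =>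
      tendsto_weightedTranslation_pow_restrict a⁻¹ (w.inverse a hwb) f hEm m
    simp only [weightProd_inverse] at hSE
    -- The first summand approximates `f`; the others are small, and the `l`-th becomes `1_{E_k}
    -- g_l` under `T ^ (r l * n k)`.
    let z : ℕ → OrliczSpace Φ μ := fun k => f.restrict (E k) (hEm k) +
      ∑ l, (S ^ (r l * n k)) ((g l).restrict (E k) (hEm k))
    have hz : Tendsto z atTop (𝓝 f) := by
      have := hfE.add (tendsto_finsetSum Finset.univ fun l _ => hSE (g l) _ (h1 l).2)
      rw [Finset.sum_const_zero, add_zero] at this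
      exact this
    have hTz : ∀ l, Tendsto (fun k => (T ^ (r l * n k)) (z k)) atTop (𝓝 (g l)) := fun l => by
      -- `T^{r_l n} S^{r_s n}` is `T^{(r_l - r_s) n}` for `s < l`, the identity for `s = l`, and
      -- `S^{(r_s - r_l) n}` for `s > l`.
      have hterm : ∀ s ∈ Finset.univ, Tendsto (fun k => (T ^ (r l * n k)) ((S ^ (r s * n k))
          ((g s).restrict (E k) (hEm k)))) atTop (𝓝 (if s = l then g l else 0)) := by
        intro s _
        simp only [← mul_apply_eq_comp]
        rcases lt_trichotomy s l with hsl | rfl | hsl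
        · rw [if_neg hsl.ne]
          refine (hTE (g s) _ (h2 s l hsl).2).congr fun k => ?_
          rw [← Nat.sub_add_cancel (hr hsl).le, add_mul, pow_add, mul_assoc, hTS, mul_one,
            Nat.add_sub_cancel]
        · simpa only [hTS, one_apply_eq_self, if_true] using hgE s
        · rw [if_neg hsl.ne']
          refine (hSE (g s) _ (h2 l s hsl).1).congr fun k => ?_
          have : r s * n k = r l * n k + (r s - r l) * n k := by
            rw [← add_mul, Nat.add_sub_cancel' (hr hsl).le]
          rw [this, pow_add S, ← mul_assoc, hTS, one_mul]
      have := (hTE f _ (h1 l).1).add (tendsto_finsetSum Finset.univ hterm)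
      rw [zero_add, Finset.sum_ite_eq' Finset.univ l, if_pos (Finset.mem_univ l)] at this
      refine this.congr fun k => ?_
      simp only [z, map_add, map_sum]
      rfl
    -- Only `n 0` may vanish, so `k ≥ 1` ensures a positive time.
    obtain ⟨k, ⟨hkU, hkV⟩, hk⟩ := (((hz.eventually_mem (hU.mem_nhds hfU)).and
      (eventually_all.2 fun l => (hTz l).eventually_mem ((hV l).mem_nhds (hgV l)))).and
      (eventually_ge_atTop 1)).exists
    refine ⟨n k, (Nat.zero_le _).trans_lt (hn hk), z k, hkU, Set.mem_iInter.2 fun l => ?_⟩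
    rw [Set.mem_preimage, ← pow_mul]
    exact hkV l
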